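/- Let $n\ge 1$, $r\ge 2$, let $C\in\mathbb{R}^{n\times n}$ be symmetric, and let $\rho,\varepsilon,\kappa>0$. Let $\mathcal M=\{\sigma\in\mathbb{R}^{n\times r}:\|\sigma_i\|=1,\ i=1,\dots,n\}$, where $\sigma_i$ is the $i$-th row of $\sigma$. Regard $\mathcal M$ as a Riemannian submanifold of $\mathbb{R}^{n\times r}$ with the Frobenius inner product $\langle\cdot,\cdot\rangle$, and put $f(\sigma)=\langle C,\sigma\sigma^\top\rangle$ and $G_\rho(\tilde\sigma,\sigma)=f(\tilde\sigma)+\frac{\rho}{2}\|\tilde\sigma-\sigma\|_F^2$. Let $\mathrm{SDP}(C)=\min\{\langle C,X\rangle: X\succeq 0,\ X_{ii}=1 \text{ for all } i\}$, let $\|C\|_1$ be the operator norm induced by the $\ell^1$ norm, and let $$f^*=\mathrm{SDP}(C)-\frac{1}{r-1}\bigl(\mathrm{SDP}(C)+\mathrm{SDP}(-C)\bigr).$$ Consider the following algorithm (ADMM-BM2). Start from $\sigma^0=\tilde\sigma^0\in\mathcal M$ and $y^0=C\tilde\sigma^0$. In iteration $k=0,1,2,\dots$: 1. Let $\tilde\sigma^{k+1}$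 be $\sigma^k-\frac1\rho(y^k+C\sigma^k)$ with each row scaled to unit length (a zero row may be replaced by any unit vector), then let $\sigma^{k+1}=\tilde\sigma^{k+1}+\frac1\rho(y^k-C\tilde\sigma^{k+1})$ and $y^{k+1}=y^k+\rho(\tilde\sigma^{k+1}-\sigma^{k+1})$. 2. If $G_\rho(\tilde\sigma^k,\sigma^k)-G_\rho(\tilde\sigma^{k+1},\sigma^{k+1})\ge\Delta:=\kappa\varepsilon^2$, go on to the next iteration. 3. Otherwise find any $u^k\in T_{\tilde\sigma^k}\mathcal M$ with $\|u^k\|_F=1$, $\langle u^k,\mathrm{grad} f(\tilde\sigma^k)\rangle\le 0$ and $\lambda_H:=\langle u^k,\mathrm{Hess} f(\tilde\sigma^k)[u^k]\rangle\le\frac12\lambda_{\min}(\mathrm{Hess} f(\tilde\sigma^k))$, where $\mathrm{grad} f$ and $\mathrm{Hess} f$ are the Riemannian gradient and Hessian on $\mathcal M$. - If $\lambda_H<-\varepsilon/2$, replace $\tilde\sigma^{k+1}$ by the point with rows $\tilde\sigma_i^k\cos(\|u_i^k\|t)+\frac{u_i^k}{\|u_i^k\|}\sin(\|u_i^k\|t)$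 (the row $\tilde\sigma_i^k$ if $u_i^k=0$), where $t=-\frac{2}{15\|C\|_1}\lambda_H$, and set $\sigma^{k+1}=\tilde\sigma^{k+1}$ and $y^{k+1}=C\tilde\sigma^{k+1}$. - Otherwise stop and return $\tilde\sigma^k$. Let $$T_1=\left\lceil\frac{f(\tilde\sigma^0)-f^*}{\kappa\varepsilon^2}\right\rceil,\qquad T_2=\left\lceil\frac{675\,\|C\|_1^2\,n}{\varepsilon^2}\right\rceil .$$ Let the algorithm run for at most $N$ iterations, where $N\ge T_1+T_2$ is a natural number; it returns the point of step 3 if it stops during these iterations, and the current point $\tilde\sigma^N$ if it does not. Then the algorithm can be carried out, and whatever admissible directions $u^k$ are found, it returns a point $\sigma\in\mathcal M$ with $$f(\sigma)\le \mathrm{SDP}(C)-\frac{1}{r-1}\bigl(\mathrm{SDP}(C)+\mathrm{SDP}(-C)\bigr)+\frac n2\,\varepsilon .$$ If $f^*\ge 0$, the same holds with $T_1=\lceil f(\tilde\sigma^0)/(\kappa\varepsilon^2)\rceil$. -/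

import Mathlib

noncomputable section

namespace ADMMBM2

/-- `n × r` real matrices, seen as `n` rows in `ℝ^r`. The inner product and the norm of this
space are the Frobenius ones. -/
abbrev Mat (n r : ℕ) : Type := PiLp 2 (fun _ : Fin n => EuclideanSpace ℝ (Fin r))

variable {n r : ℕ}

/-- The product of spheres `{σ : ‖σ_i‖ = 1 for all i}`. -/
def sphereProduct (n r : ℕ) : Set (Mat n r) := {σ | ∀ i, ‖σ i‖ = 1}

/-- The matrix product `C σ`; its `i`-th row is `∑ j, C i j • σ_j`. -/
def matMul (C : Matrix (Fin n) (Fin n) ℝ) (σ : Mat n r) : Mat n r :=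
  WithLp.toLp 2 fun i => ∑ j, C i j • σ j

/-- The objective `f σ = ⟨C, σ σᵀ⟩`. -/
def objective (C : Matrix (Fin n) (Fin n) ℝ) (σ : Mat n r) : ℝ :=
  ∑ i, ∑ j, C i j * inner ℝ (σ i) (σ j)

/-- `SDP(C)`: the optimal value of `min ⟨C, X⟩` subject to `X ⪰ 0` and `X i i = 1`. -/
def sdpValue (C : Matrix (Fin n) (Fin n) ℝ) : ℝ :=
  sInf {v | ∃ X : Matrix (Fin n) (Fin n) ℝ,
    X.PosSemidef ∧ (∀ i, X i i = 1) ∧ v = ∑ i, ∑ j, C i j * X i j}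

/-- The target value `f* = SDP(C) - (SDP(C) + SDP(-C)) / (r - 1)`. -/
def targetValue (C : Matrix (Fin n) (Fin n) ℝ) (r : ℕ) : ℝ :=
  sdpValue C - 1 / ((r : ℝ) - 1) * (sdpValue C + sdpValue (-C))

/-- The operator norm of `C` induced by the `ℓ¹` norm on `ℝⁿ`. -/
def opNormOne (C : Matrix (Fin n) (Fin n) ℝ) : ℝ :=
  ‖LinearMap.toContinuousLinearMap (Matrix.toLpLin 1 1 C)‖

/-- The tangent space at `σ` of the product of spheres. -/
def tangentSpace (σ : Mat n r) : Submodule ℝ (Mat n r) where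
  carrier := {u | ∀ i, inner ℝ (σ i) (u i) = 0}
  add_mem' := by
    intro a b ha hb i
    simp [inner_add_right, ha i, hb i]
  zero_mem' := by
    intro i
    simp
  smul_mem' := by
    intro c a ha i
    simp [inner_smul_right, ha i]

/-- For `σ` in the product of spheres, the orthogonal projection of a matrix to the tangent
space at `σ`: row by row, `v_i ↦ v_i - ⟨σ_i, v_i⟩ σ_i`. -/
def tangentProj (σ v : Mat n r) : Mat n r :=
  WithLp.toLp 2 fun i => v i - inner ℝ (σ i) (v i) • σ i

/-- The Riemannian gradient on the product of spheres, embedded in the Euclidean space of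
matrices: the tangential part of the Euclidean gradient. -/
def riemGrad (F : Mat n r → ℝ) (σ : Mat n r) : Mat n r :=
  tangentProj σ (gradient F σ)

/-- The Riemannian Hessian `Hess F(σ)[u]` for tangent `u`: the covariant derivative of the
Riemannian gradient along `u`, which on an embedded submanifold is the tangential part of the
Euclidean derivative. -/
def riemHess (F : Mat n r → ℝ) (σ u : Mat n r) : Mat n r :=
  tangentProj σ (fderiv ℝ (riemGrad F) σ u)

/-- The smallest eigenvalue of the Riemannian Hessian as an operator on the tangent space. -/
def hessMinEigenvalue (F : Mat n r → ℝ) (σ : Mat n r) : ℝ :=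
  sInf {μ | ∃ u ∈ tangentSpace σ, u ≠ 0 ∧ riemHess F σ u = μ • u}

/-- The Hessian quadratic form `⟨u, Hess F(σ)[u]⟩`. -/
def hessForm (F : Mat n r → ℝ) (σ u : Mat n r) : ℝ :=
  inner ℝ u (riemHess F σ u)

/-- The geodesic step: the point at time `t` on the geodesic that starts at `σ` with
velocity `u`. A row with `u_i = 0` does not move. -/
def geodesicStep (σ u : Mat n r) (t : ℝ) : Mat n r :=
  WithLp.toLp 2 fun i =>
    Real.cos (‖u i‖ * t) • σ i + Real.sin (‖u i‖ * t) • (‖u i‖⁻¹ • u i)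

/-- The variables of the algorithm. -/
structure State (n r : ℕ) where
  /-- The iterate `σ̃`, on the product of spheres. -/
  tilde : Mat n r
  /-- The iterate `σ`. -/
  sigma : Mat n r
  /-- The dual iterate `y`. -/
  dual : Mat n r

/-- The state with `σ = σ̃ = τ` and `y = C τ`: the initialization, and also the state after a
negative-curvature step to `τ`. -/
def restart (C : Matrix (Fin n) (Fin n) ℝ) (τ : Mat n r) : State n r :=
  ⟨τ, τ, matMul C τ⟩

/-- The function `G_ρ(σ̃, σ) = ⟨C, σ̃ σ̃ᵀ⟩ + (ρ / 2) ‖σ̃ - σ‖²`, for `σ̃` in the product of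
spheres (every `σ̃` of the algorithm is, so that the indicator function of that set is `0`). -/
def merit (C : Matrix (Fin n) (Fin n) ℝ) (ρ : ℝ) (s : State n r) : ℝ :=
  objective C s.tilde + ρ / 2 * ‖s.tilde - s.sigma‖ ^ 2

/-- `τ` is obtained from `γ` by scaling each row to unit length. A zero row, for which this is
not determined, may become any unit vector. -/
def IsNormalizeRow (γ τ : Mat n r) : Prop :=
  ∀ i, ‖τ i‖ = 1 ∧ γ i = ‖γ i‖ • τ i

/-- One ADMM update of the three variables, with penalty parameter `ρ`. -/
def AdmmStep (C : Matrix (Fin n) (Fin n) ℝ) (ρ : ℝ) (s s' : State n r) : Prop :=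
  IsNormalizeRow (s.sigma - (1 / ρ) • (s.dual + matMul C s.sigma)) s'.tilde ∧
  s'.sigma = s'.tilde + (1 / ρ) • (s.dual - matMul C s'.tilde) ∧
  s'.dual = s.dual + ρ • (s'.tilde - s'.sigma)

/-- `u` is an admissible search direction at `σ`: a unit tangent vector with
`⟨u, Hess f(σ)[u]⟩ ≤ λ_min(Hess f(σ)) / 2` and `⟨u, grad f(σ)⟩ ≤ 0`. -/
def IsCurvatureDirection (C : Matrix (Fin n) (Fin n) ℝ) (σ u : Mat n r) : Prop :=
  u ∈ tangentSpace σ ∧ ‖u‖ = 1 ∧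
  hessForm (objective C) σ u ≤ hessMinEigenvalue (objective C) σ / 2 ∧
  inner ℝ u (riemGrad (objective C) σ) ≤ 0

/-- The adaptive step length `t = -2 λ_H / (15 ‖C‖₁)`, where `λ_H = ⟨u, Hess f(σ)[u]⟩`. -/
def stepLength (C : Matrix (Fin n) (Fin n) ℝ) (σ u : Mat n r) : ℝ :=
  -(2 / (15 * opNormOne C)) * hessForm (objective C) σ u

/-- One iteration of the algorithm that goes on, from the state `s` to the state at its right:
either the ADMM update decreases `G_ρ` by at least `Δ` and is accepted, or it is discarded and
a negative-curvature step is made from `s.tilde`. -/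
inductive Continues (C : Matrix (Fin n) (Fin n) ℝ) (ρ ε Δ : ℝ) : State n r → State n r → Prop
  | admm (s s' : State n r) :
      AdmmStep C ρ s s' → Δ ≤ merit C ρ s - merit C ρ s' →
      Continues C ρ ε Δ s s'
  | curvature (s s' : State n r) (u : Mat n r) :
      AdmmStep C ρ s s' → merit C ρ s - merit C ρ s' < Δ →
      IsCurvatureDirection C s.tilde u → hessForm (objective C) s.tilde u < -(ε / 2) →
      Continues C ρ ε Δ s (restart C (geodesicStep s.tilde u (stepLength C s.tilde u)))

/-- One iteration of the algorithm that stops and returns `s.tilde`: the ADMM update does not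
decrease `G_ρ` by `Δ`, and the curvature direction found has `λ_H ≥ -ε / 2`. -/
def Stops (C : Matrix (Fin n) (Fin n) ℝ) (ρ ε Δ : ℝ) (s : State n r) : Prop :=
  ∃ (s' : State n r) (u : Mat n r),
    AdmmStep C ρ s s' ∧ merit C ρ s - merit C ρ s' < Δ ∧
    IsCurvatureDirection C s.tilde u ∧ -(ε / 2) ≤ hessForm (objective C) s.tilde u

/-- `Outputs C ρ ε Δ N s σ`: the algorithm, started in the state `s` and run for at most `N`
iterations, can return `σ`. This is the point that the algorithm returns where it stops by
itself, and the current `σ̃` if it has not stopped during the `N` iterations. The algorithm is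
not deterministic, because every admissible direction `u` may be found. -/
inductive Outputs (C : Matrix (Fin n) (Fin n) ℝ) (ρ ε Δ : ℝ) :
    ℕ → State n r → Mat n r → Prop
  | budget (s : State n r) : Outputs C ρ ε Δ 0 s s.tilde
  | halt (N : ℕ) (s : State n r) :
      Stops C ρ ε Δ s → Outputs C ρ ε Δ (N + 1) s s.tilde
  | step (N : ℕ) (s s' : State n r) (σ : Mat n r) :
      Continues C ρ ε Δ s s' → Outputs C ρ ε Δ N s' σ → Outputs C ρ ε Δ (N + 1) s σ

end ADMMBM2

end

namespace ADMMBM2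

/-! The proof rests on one landscape estimate and two potentials. The Burer–Monteiro bound
`objective_sub_targetValue_le` says that `f(σ) - f*` is at most `n/2` times `-λ_min` of the
Riemannian Hessian. It comes from summing the Hessian form over projected basis vectors weighted by
a factor of an almost optimal `X`. Since `λ_H ≤ λ_min/2`, stopping with `λ_H ≥ -ε/2` therefore
certifies the required value.

Suppose the output is too large; then the algorithm never stopped early. Each accepted update lowers
the merit by `Δ`, and no iteration raises it, so there are fewer than `T₁` such updates. At a
curvature step the gap `x` satisfies `x ≤ n(-λ_H)`, while a cubic Taylor bound along the geodesic
gives a decrease of at least `2(-λ_H)³/(675‖C‖₁²)`, hence of order `x³`. So `1/x²` grows by a fixed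
amount, yet stays below `(nε/2)⁻²`, which leaves at most `T₂` curvature steps. The total is less
than `T₁ + T₂`, a contradiction. Of the ADMM update only the normalized rows and the merit test
matter.

The algorithm can always proceed because `λ_min ≤ 0`: the Hessian form sums to zero over
infinitesimal rotations. A minimal eigenvector, with suitable sign, is then admissible. -/

/-! ### Riemannian gradient and Hessian of the objective -/

theorem matMul_add {n r : ℕ} (C : Matrix (Fin n) (Fin n) ℝ) (σ τ : Mat n r) :
    matMul C (σ + τ) = matMul C σ + matMul C τ := by
  ext1 i
  change ∑ j, C i j • (σ j + τ j) = ∑ j, C i j • σ j + ∑ j, C i j • τ j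
  simp only [smul_add, Finset.sum_add_distrib]

theorem matMul_smul {n r : ℕ} (C : Matrix (Fin n) (Fin n) ℝ) (c : ℝ) (σ : Mat n r) :
    matMul C (c • σ) = c • matMul C σ := by
  ext1 i
  change ∑ j, C i j • (c • σ j) = c • ∑ j, C i j • σ j
  simp only [Finset.smul_sum, smul_comm c]

theorem continuous_matMul {n r : ℕ} (C : Matrix (Fin n) (Fin n) ℝ) :
    Continuous (matMul C : Mat n r → Mat n r) := by
  refine (PiLp.continuous_toLp 2 _).comp
    (continuous_pi fun i => continuous_finsetSum _ fun j _ => ?_)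
  exact (PiLp.continuous_apply 2 (fun _ : Fin n => EuclideanSpace ℝ (Fin r)) j).const_smul (C i j)

/-- Left multiplication by `C` as a continuous linear map. -/
noncomputable def matMulCLM {n r : ℕ} (C : Matrix (Fin n) (Fin n) ℝ) : Mat n r →L[ℝ] Mat n r where
  toFun := matMul C
  map_add' := matMul_add C
  map_smul' := matMul_smul C
  cont := continuous_matMul C

@[simp] theorem matMulCLM_apply {n r : ℕ} (C : Matrix (Fin n) (Fin n) ℝ) (σ : Mat n r) :
    matMulCLM C σ = matMul C σ := rfl

theorem matMul_row {n r : ℕ} (C : Matrix (Fin n) (Fin n) ℝ) (σ : Mat n r) (i : Fin n) :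
    matMul C σ i = ∑ j, C i j • σ j := rfl

theorem tangentProj_row {n r : ℕ} (σ v : Mat n r) (i : Fin n) :
    tangentProj σ v i = v i - inner ℝ (σ i) (v i) • σ i := rfl

theorem inner_matMul {n r : ℕ} (C : Matrix (Fin n) (Fin n) ℝ) (σ τ : Mat n r) :
    inner ℝ σ (matMul C τ) = ∑ i, ∑ j, C i j * inner ℝ (σ i) (τ j) := by
  simp [PiLp.inner_apply, matMul_row, inner_sum, inner_smul_right]

theorem inner_matMul_comm {n r : ℕ} {C : Matrix (Fin n) (Fin n) ℝ} (hC : C.IsSymm)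
    (σ τ : Mat n r) : inner ℝ σ (matMul C τ) = inner ℝ τ (matMul C σ) := by
  rw [inner_matMul, inner_matMul, Finset.sum_comm]
  refine Finset.sum_congr rfl fun i _ => Finset.sum_congr rfl fun j _ => ?_
  rw [hC.apply i j, real_inner_comm]

theorem objective_eq_inner {n r : ℕ} (C : Matrix (Fin n) (Fin n) ℝ) (σ : Mat n r) :
    objective C σ = inner ℝ σ (matMul C σ) := (inner_matMul C σ σ).symm

theorem hasGradientAt_objective {n r : ℕ} {C : Matrix (Fin n) (Fin n) ℝ} (hC : C.IsSymm)
    (σ : Mat n r) : HasGradientAt (objective C) ((2 : ℝ) • matMul C σ) σ := by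
  rw [hasGradientAt_iff_hasFDerivAt]
  have h := (hasFDerivAt_id (𝕜 := ℝ) σ).inner ℝ (matMulCLM C).hasFDerivAt
  have e : objective C = fun τ : Mat n r => inner ℝ (id τ) (matMulCLM C τ) := by
    funext τ
    simp [objective_eq_inner]
  rw [e]
  refine h.congr_fderiv ?_
  ext u
  simp only [ContinuousLinearMap.comp_apply, ContinuousLinearMap.prod_apply,
    fderivInnerCLM_apply, matMulCLM_apply, id, ContinuousLinearMap.id_apply,
    InnerProductSpace.toDual_apply_apply, real_inner_smul_left]
  rw [inner_matMul_comm hC σ u, real_inner_comm (matMul C σ) u]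
  ring

theorem riemGrad_objective {n r : ℕ} {C : Matrix (Fin n) (Fin n) ℝ} (hC : C.IsSymm) :
    riemGrad (objective C) = fun σ : Mat n r => tangentProj σ ((2 : ℝ) • matMul C σ) := by
  funext σ
  rw [riemGrad, (hasGradientAt_objective hC σ).gradient]

/-- The product rule for one row of the Riemannian gradient: `p` stands for the row of `σ` and `q`
for the row of `C σ`. -/
theorem exists_hasFDerivAt_sub_inner_smul {E F : Type*} [NormedAddCommGroup E] [NormedSpace ℝ E]
    [NormedAddCommGroup F] [InnerProductSpace ℝ F] (p q : E →L[ℝ] F) (x : E) :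
    ∃ L : E →L[ℝ] F,
      HasFDerivAt (fun y => (2 : ℝ) • q y - inner ℝ (p y) ((2 : ℝ) • q y) • p y) L x ∧
      ∀ u, L u = (2 : ℝ) • q u - (2 * inner ℝ (p x) (q x)) • p u
        - (2 * (inner ℝ (p x) (q u) + inner ℝ (p u) (q x))) • p x := by
  have hq := q.hasFDerivAt (x := x).const_smul (2 : ℝ)
  refine ⟨_, hq.sub ((p.hasFDerivAt.inner ℝ hq).smul p.hasFDerivAt), fun u => ?_⟩
  simp [real_inner_smul_right]
  module

/-- The `i`-th row as a continuous linear map. -/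
noncomputable def rowCLM {n r : ℕ} (i : Fin n) : Mat n r →L[ℝ] EuclideanSpace ℝ (Fin r) where
  toFun := fun σ => σ i
  map_add' := fun _ _ => rfl
  map_smul' := fun _ _ => rfl
  cont := PiLp.continuous_apply 2 (fun _ : Fin n => EuclideanSpace ℝ (Fin r)) i

theorem _root_.ContinuousLinearMap.apply_fderiv_eq {E F G : Type*} [NormedAddCommGroup E]
    [NormedSpace ℝ E] [NormedAddCommGroup F] [NormedSpace ℝ F] [NormedAddCommGroup G]
    [NormedSpace ℝ G] (p : F →L[ℝ] G) {f : E → F} {x : E} (hf : DifferentiableAt ℝ f x)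
    {L : E →L[ℝ] G} (hL : HasFDerivAt (fun y => p (f y)) L x) (u : E) :
    p (fderiv ℝ f x u) = L u :=
  congrArg (fun T => T u) ((p.hasFDerivAt.comp x hf.hasFDerivAt).unique hL)

theorem differentiable_toLp_rows {E : Type*} [NormedAddCommGroup E] [NormedSpace ℝ E] {n r : ℕ}
    {f : E → Mat n r} {x : E} (hf : ∀ i, DifferentiableAt ℝ (fun y => f y i) x) :
    DifferentiableAt ℝ f x := (differentiableAt_piLp 2).2 hf

theorem fderiv_riemGrad_objective_row {n r : ℕ} {C : Matrix (Fin n) (Fin n) ℝ} (hC : C.IsSymm)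
    (σ u : Mat n r) (i : Fin n) :
    fderiv ℝ (riemGrad (objective C)) σ u i = (2 : ℝ) • matMul C u i
      - (2 * inner ℝ (σ i) (matMul C σ i)) • u i
      - (2 * (inner ℝ (σ i) (matMul C u i) + inner ℝ (u i) (matMul C σ i))) • σ i := by
  have hG := fun i : Fin n =>
    exists_hasFDerivAt_sub_inner_smul (rowCLM i) ((rowCLM i).comp (matMulCLM C)) σ
  have hd : DifferentiableAt ℝ (riemGrad (objective C)) σ := by
    rw [riemGrad_objective hC]
    refine differentiable_toLp_rows fun i => ?_
    obtain ⟨L, hL, -⟩ := hG i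
    exact hL.differentiableAt
  obtain ⟨L, hL, hLu⟩ := hG i
  have h2 : rowCLM i (fderiv ℝ (riemGrad (objective C)) σ u) = L u := by
    refine (rowCLM i).apply_fderiv_eq hd ?_ u
    rw [riemGrad_objective hC]
    exact hL
  exact h2.trans (hLu u)

theorem riemHess_objective_row {n r : ℕ} {C : Matrix (Fin n) (Fin n) ℝ} (hC : C.IsSymm)
    {σ u : Mat n r} (hσ : σ ∈ sphereProduct n r) (hu : u ∈ tangentSpace σ) (i : Fin n) :
    riemHess (objective C) σ u i = (2 : ℝ) • matMul C u i
      - (2 * inner ℝ (σ i) (matMul C u i)) • σ i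
      - (2 * inner ℝ (σ i) (matMul C σ i)) • u i := by
  have h1 : inner ℝ (σ i) (u i) = 0 := hu i
  have h2 : inner ℝ (σ i) (σ i) = 1 := by rw [real_inner_self_eq_norm_sq, hσ i, one_pow]
  rw [riemHess, tangentProj_row, fderiv_riemGrad_objective_row hC]
  simp only [inner_sub_right, real_inner_smul_right, h1, h2]
  module

theorem tangentProj_mem {n r : ℕ} {σ : Mat n r} (hσ : σ ∈ sphereProduct n r) (v : Mat n r) :
    tangentProj σ v ∈ tangentSpace σ := by
  intro i
  have h2 : inner ℝ (σ i) (σ i) = 1 := by rw [real_inner_self_eq_norm_sq, hσ i, one_pow]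
  rw [tangentProj_row, inner_sub_right, real_inner_smul_right, h2]
  ring

theorem inner_riemHess_objective {n r : ℕ} {C : Matrix (Fin n) (Fin n) ℝ} (hC : C.IsSymm)
    {σ u v : Mat n r} (hσ : σ ∈ sphereProduct n r) (hu : u ∈ tangentSpace σ)
    (hv : v ∈ tangentSpace σ) :
    inner ℝ v (riemHess (objective C) σ u) = 2 * (inner ℝ v (matMul C u)
      - ∑ i, inner ℝ (σ i) (matMul C σ i) * inner ℝ (v i) (u i)) := by
  rw [PiLp.inner_apply, PiLp.inner_apply, ← Finset.sum_sub_distrib, Finset.mul_sum]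
  refine Finset.sum_congr rfl fun i _ => ?_
  have h1 : inner ℝ (v i) (σ i) = 0 := by rw [real_inner_comm]; exact hv i
  rw [riemHess_objective_row hC hσ hu]
  simp only [inner_sub_right, real_inner_smul_right, h1]
  ring

/-- In this form the Hessian depends on `u` only through its Gram matrix, so sums over families of
tangent vectors can be evaluated entry by entry. -/
theorem hessForm_objective {n r : ℕ} {C : Matrix (Fin n) (Fin n) ℝ} (hC : C.IsSymm)
    {σ u : Mat n r} (hσ : σ ∈ sphereProduct n r) (hu : u ∈ tangentSpace σ) :
    hessForm (objective C) σ u = 2 * ((∑ i, ∑ j, C i j * inner ℝ (u i) (u j))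
      - ∑ i, ∑ j, C i j * (inner ℝ (σ i) (σ j) * ‖u i‖ ^ 2)) := by
  rw [hessForm, inner_riemHess_objective hC hσ hu hu, inner_matMul]
  congr 2
  refine Finset.sum_congr rfl fun i _ => ?_
  rw [matMul_row, inner_sum, Finset.sum_mul]
  refine Finset.sum_congr rfl fun j _ => ?_
  rw [real_inner_smul_right, real_inner_self_eq_norm_sq, mul_assoc]

theorem inner_riemGrad_objective {n r : ℕ} {C : Matrix (Fin n) (Fin n) ℝ} (hC : C.IsSymm)
    {σ u : Mat n r} (hu : u ∈ tangentSpace σ) :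
    inner ℝ u (riemGrad (objective C) σ) = 2 * ∑ i, ∑ j, C i j * inner ℝ (u i) (σ j) := by
  rw [← inner_matMul, riemGrad_objective hC, PiLp.inner_apply, PiLp.inner_apply, Finset.mul_sum]
  refine Finset.sum_congr rfl fun i _ => ?_
  have h1 : inner ℝ (u i) (σ i) = 0 := by rw [real_inner_comm]; exact hu i
  rw [tangentProj_row, inner_sub_right, real_inner_smul_right, h1, PiLp.smul_apply,
    real_inner_smul_right]
  ring

/-! ### The smallest Hessian eigenvalue and admissible directions -/

/-- An operator that restricts to a symmetric operator on a nontrivial finite-dimensional subspace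
attains the minimum of its Rayleigh quotient there, and this minimum is the smallest eigenvalue of
the restriction. -/
theorem exists_unit_eigenvector_sInf {E : Type*} [NormedAddCommGroup E] [InnerProductSpace ℝ E]
    [FiniteDimensional ℝ E] (V : Submodule ℝ E) (H : E →ₗ[ℝ] E) (hV : ∀ u ∈ V, H u ∈ V)
    (hH : ∀ u ∈ V, ∀ v ∈ V, inner ℝ v (H u) = inner ℝ u (H v)) (hne : ∃ u ∈ V, u ≠ 0) :
    (∃ e ∈ V, ‖e‖ = 1 ∧ H e = sInf {μ : ℝ | ∃ u ∈ V, u ≠ 0 ∧ H u = μ • u} • e) ∧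
      ∀ u ∈ V, sInf {μ : ℝ | ∃ u ∈ V, u ≠ 0 ∧ H u = μ • u} * ‖u‖ ^ 2 ≤ inner ℝ u (H u) := by
  obtain ⟨u₀, hu₀, hu₀'⟩ := hne
  have : Nontrivial V := ⟨⟨⟨u₀, hu₀⟩, 0, fun h => hu₀' (congrArg Subtype.val h)⟩⟩
  set S : V →ₗ[ℝ] V := H.restrict hV with hS
  have hsymm : S.IsSymmetric := by
    intro x y
    change inner ℝ (H x) (y : E) = inner ℝ (x : E) (H y)
    rw [real_inner_comm]
    exact hH _ x.2 _ y.2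
  obtain ⟨x, hx⟩ := hsymm.hasEigenvalue_iInf_of_finiteDimensional.exists_hasEigenvector
  set m : ℝ := ⨅ x : { x : V // x ≠ 0 }, RCLike.re (inner ℝ (S x) (x : V)) / ‖(x : V)‖ ^ 2 with hm
  -- By Cauchy–Schwarz; without a lower bound the real infimum would carry no information.
  have hbdd : BddBelow (Set.range fun x : { x : V // x ≠ 0 } =>
      RCLike.re (inner ℝ (S x) (x : V)) / ‖(x : V)‖ ^ 2) := by
    refine ⟨-‖LinearMap.toContinuousLinearMap S‖, ?_⟩
    rintro _ ⟨⟨y, hy⟩, rfl⟩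
    have hy' : 0 < ‖y‖ := norm_pos_iff.2 hy
    have h1 : ‖S y‖ ≤ ‖LinearMap.toContinuousLinearMap S‖ * ‖y‖ :=
      (LinearMap.toContinuousLinearMap S).le_opNorm y
    have h2 := neg_le_of_abs_le (abs_real_inner_le_norm (S y) y)
    change _ ≤ inner ℝ (S y) y / ‖y‖ ^ 2
    rw [le_div_iff₀ (by positivity)]
    nlinarith
  have hle : ∀ u ∈ V, m * ‖u‖ ^ 2 ≤ inner ℝ u (H u) := by
    intro u hu
    by_cases h0 : u = 0
    · simp [h0]
    have hpos : 0 < ‖u‖ := norm_pos_iff.2 h0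
    have h1 : m ≤ inner ℝ (H u) u / ‖u‖ ^ 2 :=
      ciInf_le hbdd ⟨⟨u, hu⟩, fun h => h0 (congrArg Subtype.val h)⟩
    rw [le_div_iff₀ (by positivity), real_inner_comm] at h1
    exact h1
  have hxH : H x = m • (x : E) := congrArg Subtype.val hx.apply_eq_smul
  have hx0 : (x : E) ≠ 0 := fun h => hx.2 (Subtype.ext h)
  have hset : sInf {μ : ℝ | ∃ u ∈ V, u ≠ 0 ∧ H u = μ • u} = m := by
    refine IsLeast.csInf_eq ⟨⟨x, x.2, hx0, hxH⟩, ?_⟩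
    rintro μ ⟨u, hu, hu0, hμ⟩
    have h1 := hle u hu
    have hpos : 0 < ‖u‖ := norm_pos_iff.2 hu0
    rw [hμ, real_inner_smul_right, real_inner_self_eq_norm_sq] at h1
    exact le_of_mul_le_mul_right h1 (by positivity)
  rw [hset]
  refine ⟨⟨‖(x : E)‖⁻¹ • (x : E), V.smul_mem _ x.2, ?_, ?_⟩, hle⟩
  · rw [norm_smul, norm_inv, norm_norm, inv_mul_cancel₀ (norm_ne_zero_iff.2 hx0)]
  · rw [map_smul, hxH, smul_comm]

theorem tangentProj_add {n r : ℕ} (σ u v : Mat n r) :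
    tangentProj σ (u + v) = tangentProj σ u + tangentProj σ v := by
  ext1 i
  change (u i + v i) - inner ℝ (σ i) (u i + v i) • σ i
    = (u i - inner ℝ (σ i) (u i) • σ i) + (v i - inner ℝ (σ i) (v i) • σ i)
  rw [inner_add_right]
  module

theorem tangentProj_smul {n r : ℕ} (σ : Mat n r) (c : ℝ) (u : Mat n r) :
    tangentProj σ (c • u) = c • tangentProj σ u := by
  ext1 i
  change c • u i - inner ℝ (σ i) (c • u i) • σ i = c • (u i - inner ℝ (σ i) (u i) • σ i)
  rw [real_inner_smul_right]
  module

/-- The Riemannian Hessian as a linear map on the ambient space. -/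
noncomputable def riemHessLin {n r : ℕ} (F : Mat n r → ℝ) (σ : Mat n r) :
    Mat n r →ₗ[ℝ] Mat n r where
  toFun := riemHess F σ
  map_add' := fun u v => by
    rw [riemHess, map_add, tangentProj_add]
    rfl
  map_smul' := fun c u => by
    rw [riemHess, map_smul, tangentProj_smul]
    rfl

/-- The infinitesimal rotation `x ↦ x_a e_b - x_b e_a` of the rows of `σ`. -/
noncomputable def planeRotation {n r : ℕ} (a b : Fin r) (σ : Mat n r) : Mat n r :=
  WithLp.toLp 2 fun i =>
    σ i a • EuclideanSpace.single b (1 : ℝ) - σ i b • EuclideanSpace.single a (1 : ℝ)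

theorem planeRotation_row {n r : ℕ} (a b : Fin r) (σ : Mat n r) (i : Fin n) :
    planeRotation a b σ i =
      σ i a • EuclideanSpace.single b (1 : ℝ) - σ i b • EuclideanSpace.single a (1 : ℝ) := rfl

theorem planeRotation_mem {n r : ℕ} (a b : Fin r) (σ : Mat n r) :
    planeRotation a b σ ∈ tangentSpace σ := by
  intro i
  rw [planeRotation_row]
  simp [inner_sub_right, real_inner_smul_right, EuclideanSpace.inner_single_right]
  ring

/-- Ordered pairs count every plane twice, and the pairs `a = b` contribute zero; the `if` in the
proof removes these. -/
theorem sum_inner_planeRotation {n r : ℕ} (σ : Mat n r) (i j : Fin n) :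
    ∑ a, ∑ b, inner ℝ (planeRotation a b σ i) (planeRotation a b σ j)
      = 2 * ((r : ℝ) - 1) * inner ℝ (σ i) (σ j) := by
  have h : ∀ a b : Fin r, inner ℝ (planeRotation a b σ i) (planeRotation a b σ j)
      = σ i a * σ j a + σ i b * σ j b
        - if a = b then σ i a * σ j b + σ i b * σ j a else 0 := by
    intro a b
    rw [planeRotation_row, planeRotation_row]
    by_cases hab : a = b
    · subst hab
      simp
    · simp [inner_sub_right, inner_sub_left, real_inner_smul_right,
        EuclideanSpace.inner_single_right, hab, Ne.symm hab]
      ring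
  simp only [h, Finset.sum_sub_distrib, Finset.sum_add_distrib, Finset.sum_ite_eq,
    Finset.mem_univ, if_true, Finset.sum_const, Finset.card_univ, Fintype.card_fin, nsmul_eq_mul,
    ← Finset.mul_sum]
  have h2 : inner ℝ (σ i) (σ j) = ∑ a, σ i a * σ j a := by
    simp [PiLp.inner_apply, mul_comm]
  rw [h2]
  ring

theorem sum_comm_pairs {ι κ α β : Type*} [Fintype ι] [Fintype κ] [Fintype α] [Fintype β]
    (g : ι → κ → α → β → ℝ) :
    ∑ a, ∑ b, ∑ i, ∑ j, g a b i j = ∑ i, ∑ j, ∑ a, ∑ b, g a b i j := by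
  calc _ = ∑ a, ∑ i, ∑ b, ∑ j, g a b i j := Finset.sum_congr rfl fun a _ => Finset.sum_comm
    _ = ∑ i, ∑ a, ∑ b, ∑ j, g a b i j := Finset.sum_comm
    _ = ∑ i, ∑ a, ∑ j, ∑ b, g a b i j :=
      Finset.sum_congr rfl fun i _ => Finset.sum_congr rfl fun a _ => Finset.sum_comm
    _ = _ := Finset.sum_congr rfl fun i _ => Finset.sum_comm

/-- The summed Gram matrix of the rotations is a multiple of `σσᵀ`, so with unit rows the two parts
of the Hessian form cancel. A single rotation need not give zero away from critical points. -/
theorem sum_hessForm_planeRotation {n r : ℕ} {C : Matrix (Fin n) (Fin n) ℝ} (hC : C.IsSymm)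
    {σ : Mat n r} (hσ : σ ∈ sphereProduct n r) :
    ∑ a, ∑ b, hessForm (objective C) σ (planeRotation a b σ) = 0 := by
  simp only [hessForm_objective hC hσ (planeRotation_mem _ _ σ), ← Finset.mul_sum,
    Finset.sum_sub_distrib, ← real_inner_self_eq_norm_sq]
  have swap := fun g : Fin r → Fin r → Fin n → Fin n → ℝ => sum_comm_pairs g
  rw [swap, swap]
  simp only [← Finset.mul_sum, sum_inner_planeRotation]
  refine mul_eq_zero_of_right _ (sub_eq_zero.2 ?_)
  refine Finset.sum_congr rfl fun i _ => Finset.sum_congr rfl fun j _ => ?_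
  rw [real_inner_self_eq_norm_sq, hσ i]
  ring

/-- The squared lengths of a unit row's images add up to `2(r - 1)`, positive because `r ≥ 2`. -/
theorem exists_planeRotation_ne_zero {n r : ℕ} (hn : 1 ≤ n) (hr : 2 ≤ r) {σ : Mat n r}
    (hσ : σ ∈ sphereProduct n r) : ∃ a b, planeRotation a b σ ≠ 0 := by
  by_contra! h
  have h1 := sum_inner_planeRotation σ ⟨0, hn⟩ ⟨0, hn⟩
  rw [real_inner_self_eq_norm_sq, hσ] at h1
  have h2 : (2 : ℝ) ≤ r := by exact_mod_cast hr
  simp only [h, PiLp.zero_apply, inner_zero_left, Finset.sum_const_zero] at h1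
  linarith

theorem exists_hessForm_nonpos {n r : ℕ} (hn : 1 ≤ n) (hr : 2 ≤ r)
    {C : Matrix (Fin n) (Fin n) ℝ} (hC : C.IsSymm) {σ : Mat n r} (hσ : σ ∈ sphereProduct n r) :
    ∃ u ∈ tangentSpace σ, u ≠ 0 ∧ hessForm (objective C) σ u ≤ 0 := by
  by_contra! h
  obtain ⟨a₀, b₀, h0⟩ := exists_planeRotation_ne_zero hn hr hσ
  have hnn : ∀ a b, 0 ≤ hessForm (objective C) σ (planeRotation a b σ) := by
    intro a b
    by_cases hz : planeRotation a b σ = 0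
    · rw [hz, hessForm, inner_zero_left]
    · exact (h _ (planeRotation_mem a b σ) hz).le
  have hsum := sum_hessForm_planeRotation hC hσ
  rw [Finset.sum_eq_zero_iff_of_nonneg fun a _ => Finset.sum_nonneg fun b _ => hnn a b] at hsum
  have h1 := hsum a₀ (Finset.mem_univ _)
  rw [Finset.sum_eq_zero_iff_of_nonneg fun b _ => hnn a₀ b] at h1
  exact (h _ (planeRotation_mem a₀ b₀ σ) h0).ne' (h1 b₀ (Finset.mem_univ _))

theorem hessMinEigenvalue_spec {n r : ℕ} (hn : 1 ≤ n) (hr : 2 ≤ r)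
    {C : Matrix (Fin n) (Fin n) ℝ} (hC : C.IsSymm) {σ : Mat n r} (hσ : σ ∈ sphereProduct n r) :
    (∃ e ∈ tangentSpace σ, ‖e‖ = 1 ∧
      riemHess (objective C) σ e = hessMinEigenvalue (objective C) σ • e) ∧
    ∀ u ∈ tangentSpace σ,
      hessMinEigenvalue (objective C) σ * ‖u‖ ^ 2 ≤ hessForm (objective C) σ u := by
  obtain ⟨u₀, hu₀, hne, -⟩ := exists_hessForm_nonpos hn hr hC hσ
  refine exists_unit_eigenvector_sInf (tangentSpace σ) (riemHessLin (objective C) σ)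
    (fun u _ => tangentProj_mem hσ _) ?_ ⟨u₀, hu₀, hne⟩
  intro u hu v hv
  change inner ℝ v (riemHess _ _ _) = inner ℝ u (riemHess _ _ _)
  rw [inner_riemHess_objective hC hσ hu hv, inner_riemHess_objective hC hσ hv hu,
    inner_matMul_comm hC]
  simp only [real_inner_comm]

theorem hessMinEigenvalue_nonpos {n r : ℕ} (hn : 1 ≤ n) (hr : 2 ≤ r)
    {C : Matrix (Fin n) (Fin n) ℝ} (hC : C.IsSymm) {σ : Mat n r} (hσ : σ ∈ sphereProduct n r) :
    hessMinEigenvalue (objective C) σ ≤ 0 := by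
  obtain ⟨u, hu, hne, hle⟩ := exists_hessForm_nonpos hn hr hC hσ
  have h1 := (hessMinEigenvalue_spec hn hr hC hσ).2 u hu
  have hpos : 0 < ‖u‖ ^ 2 := by
    have := norm_pos_iff.2 hne
    positivity
  by_contra! h
  nlinarith [mul_pos h hpos]

/-- A unit minimal eigenvector works: `λ_min ≤ 0` gives `λ_min ≤ λ_min / 2`, and its sign is free to
meet the gradient condition. -/
theorem exists_isCurvatureDirection {n r : ℕ} (hn : 1 ≤ n) (hr : 2 ≤ r)
    {C : Matrix (Fin n) (Fin n) ℝ} (hC : C.IsSymm) {σ : Mat n r} (hσ : σ ∈ sphereProduct n r) :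
    ∃ u, IsCurvatureDirection C σ u := by
  obtain ⟨⟨e, he, he1, hev⟩, -⟩ := hessMinEigenvalue_spec hn hr hC hσ
  have hnp := hessMinEigenvalue_nonpos hn hr hC hσ
  have key : ∀ u ∈ tangentSpace σ, ‖u‖ = 1 →
      riemHess (objective C) σ u = hessMinEigenvalue (objective C) σ • u →
      hessForm (objective C) σ u ≤ hessMinEigenvalue (objective C) σ / 2 := by
    intro u _ hu1 hH
    rw [hessForm, hH, real_inner_smul_right, real_inner_self_eq_norm_sq, hu1]
    linarith
  rcases le_total (inner ℝ e (riemGrad (objective C) σ)) 0 with h | h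
  · exact ⟨e, he, he1, key e he he1 hev, h⟩
  · refine ⟨-e, (tangentSpace σ).neg_mem he, (norm_neg e).trans he1,
      key _ ((tangentSpace σ).neg_mem he) ((norm_neg e).trans he1) ?_, ?_⟩
    · rw [smul_neg, ← hev]
      exact map_neg (riemHessLin (objective C) σ) e
    · rw [inner_neg_left]
      linarith

/-! ### The Burer–Monteiro bound -/

open scoped Matrix

theorem posSemidef_exists_factor {n : ℕ} {X : Matrix (Fin n) (Fin n) ℝ} (hX : X.PosSemidef) :
    ∃ (m : ℕ) (v : Fin m → Fin n → ℝ), ∀ i j, X i j = ∑ b, v b i * v b j := by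
  obtain ⟨m, v, hv⟩ := Matrix.posSemidef_iff_eq_sum_vecMulVec.1 hX
  refine ⟨m, v, fun i j => ?_⟩
  rw [hv, Matrix.sum_apply]
  simp [Matrix.vecMulVec_apply]

/-- The AM-GM inequality on the factors of `X`. This bounds the SDP values from below, so that
`sInf` is a genuine infimum. -/
theorem abs_entry_le_one {n : ℕ} {X : Matrix (Fin n) (Fin n) ℝ} (hX : X.PosSemidef)
    (hd : ∀ i, X i i = 1) (i j : Fin n) : |X i j| ≤ 1 := by
  obtain ⟨m, v, hv⟩ := posSemidef_exists_factor hX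
  have hi := hd i
  have hj := hd j
  rw [hv] at hi hj ⊢
  have h1 : ∑ b, |v b i * v b j| ≤ ∑ b, (v b i * v b i + v b j * v b j) / 2 := by
    refine Finset.sum_le_sum fun b _ => abs_le.2 ⟨?_, ?_⟩
    · nlinarith [sq_nonneg (v b i + v b j)]
    · nlinarith [sq_nonneg (v b i - v b j)]
  rw [← Finset.sum_div, Finset.sum_add_distrib, hi, hj] at h1
  exact (Finset.abs_sum_le_sum_abs _ _).trans (h1.trans (by norm_num))

theorem bddBelow_sdp_values {n : ℕ} (C : Matrix (Fin n) (Fin n) ℝ) :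
    BddBelow {v | ∃ X : Matrix (Fin n) (Fin n) ℝ,
      X.PosSemidef ∧ (∀ i, X i i = 1) ∧ v = ∑ i, ∑ j, C i j * X i j} := by
  refine ⟨∑ i, ∑ j, -|C i j|, ?_⟩
  rintro _ ⟨X, hX, hd, rfl⟩
  refine Finset.sum_le_sum fun i _ => Finset.sum_le_sum fun j _ => ?_
  refine neg_le_of_abs_le ?_
  rw [abs_mul]
  exact mul_le_of_le_one_right (abs_nonneg _) (abs_entry_le_one hX hd i j)

theorem sdpValue_le {n : ℕ} (C : Matrix (Fin n) (Fin n) ℝ) {X : Matrix (Fin n) (Fin n) ℝ}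
    (hX : X.PosSemidef) (hd : ∀ i, X i i = 1) : sdpValue C ≤ ∑ i, ∑ j, C i j * X i j :=
  csInf_le (bddBelow_sdp_values C) ⟨X, hX, hd, rfl⟩

/-- Near-minimizers suffice below, so attainment of the SDP minimum is not needed. The identity
matrix is feasible. -/
theorem exists_feasible_lt {n : ℕ} (C : Matrix (Fin n) (Fin n) ℝ) {η : ℝ} (hη : 0 < η) :
    ∃ X : Matrix (Fin n) (Fin n) ℝ, X.PosSemidef ∧ (∀ i, X i i = 1) ∧
      ∑ i, ∑ j, C i j * X i j < sdpValue C + η := by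
  obtain ⟨_, ⟨X, hX, hd, rfl⟩, h⟩ := Real.lt_sInf_add_pos
    (s := {v | ∃ X : Matrix (Fin n) (Fin n) ℝ,
      X.PosSemidef ∧ (∀ i, X i i = 1) ∧ v = ∑ i, ∑ j, C i j * X i j})
    ⟨_, 1, Matrix.PosSemidef.one, fun i => Matrix.one_apply_eq i, rfl⟩ hη
  exact ⟨X, hX, hd, h⟩

/-- The tangent vector at `σ` whose rows are the projections of the multiples `w_i e_a` of the
`a`-th basis vector. -/
noncomputable def projectedBasis {n r : ℕ} (σ : Mat n r) (w : Fin n → ℝ) (a : Fin r) : Mat n r :=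
  WithLp.toLp 2 fun i => w i • (EuclideanSpace.single a (1 : ℝ) - σ i a • σ i)

theorem projectedBasis_row {n r : ℕ} (σ : Mat n r) (w : Fin n → ℝ) (a : Fin r) (i : Fin n) :
    projectedBasis σ w a i = w i • (EuclideanSpace.single a (1 : ℝ) - σ i a • σ i) := rfl

theorem projectedBasis_mem {n r : ℕ} {σ : Mat n r} (hσ : σ ∈ sphereProduct n r)
    (w : Fin n → ℝ) (a : Fin r) : projectedBasis σ w a ∈ tangentSpace σ := by
  intro i
  have h2 : inner ℝ (σ i) (σ i) = 1 := by rw [real_inner_self_eq_norm_sq, hσ i, one_pow]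
  rw [projectedBasis_row, real_inner_smul_right, inner_sub_right, real_inner_smul_right, h2,
    EuclideanSpace.inner_single_right]
  simp

/-- Up to the weights this is the trace of the product of the projections orthogonal to `σ_i` and
`σ_j`. -/
theorem sum_inner_projectedBasis {n r : ℕ} {σ : Mat n r} (w : Fin n → ℝ) (i j : Fin n)
    (hi : ‖σ i‖ = 1) (hj : ‖σ j‖ = 1) :
    ∑ a, inner ℝ (projectedBasis σ w a i) (projectedBasis σ w a j)
      = w i * w j * ((r : ℝ) - 2 + inner ℝ (σ i) (σ j) ^ 2) := by
  have h : ∀ a : Fin r, inner ℝ (projectedBasis σ w a i) (projectedBasis σ w a j)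
      = w i * w j * (1 - σ i a * σ i a - σ j a * σ j a
        + (σ i a * σ j a) * inner ℝ (σ i) (σ j)) := by
    intro a
    rw [projectedBasis_row, projectedBasis_row]
    simp only [inner_sub_right, inner_sub_left, real_inner_smul_right, real_inner_smul_left,
      EuclideanSpace.inner_single_right, EuclideanSpace.inner_single_left]
    simp
    ring
  have hin : ∀ k l : Fin n, ∑ a, σ k a * σ l a = inner ℝ (σ k) (σ l) := by
    intro k l
    simp [PiLp.inner_apply, mul_comm]
  simp only [h, ← Finset.mul_sum, Finset.sum_sub_distrib, Finset.sum_add_distrib,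
    ← Finset.sum_mul, hin, real_inner_self_eq_norm_sq, hi, hj, Finset.sum_const, Finset.card_univ,
    Fintype.card_fin, nsmul_eq_mul]
  ring

/-- The Burer–Monteiro bound against a feasible point of the semidefinite program. -/
theorem objective_le_of_feasible {n r : ℕ} (hn : 1 ≤ n) (hr : 2 ≤ r)
    {C : Matrix (Fin n) (Fin n) ℝ} (hC : C.IsSymm) {σ : Mat n r} (hσ : σ ∈ sphereProduct n r)
    {X : Matrix (Fin n) (Fin n) ℝ} (hX : X.PosSemidef) (hd : ∀ i, X i i = 1) :
    hessMinEigenvalue (objective C) σ * (n * ((r : ℝ) - 1)) ≤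
      2 * ((((r : ℝ) - 2) * ∑ i, ∑ j, C i j * X i j) - sdpValue (-C)
        - ((r : ℝ) - 1) * objective C σ) := by
  obtain ⟨m, v, hv⟩ := posSemidef_exists_factor hX
  have hmin := (hessMinEigenvalue_spec hn hr hC hσ).2
  set lam := hessMinEigenvalue (objective C) σ
  -- Test the Hessian on all projected basis vectors, with the factors `v b` of `X` as weights; the
  -- sum over `b` restores `X`.
  have hsum : ∑ b, ∑ a, lam * ‖projectedBasis σ (v b) a‖ ^ 2
      ≤ ∑ b, ∑ a, hessForm (objective C) σ (projectedBasis σ (v b) a) :=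
    Finset.sum_le_sum fun b _ => Finset.sum_le_sum fun a _ => hmin _ (projectedBasis_mem hσ _ _)
  have hgram : ∀ i j, ∑ b, ∑ a,
      inner ℝ (projectedBasis σ (v b) a i) (projectedBasis σ (v b) a j)
        = X i j * ((r : ℝ) - 2 + inner ℝ (σ i) (σ j) ^ 2) := by
    intro i j
    simp only [sum_inner_projectedBasis _ i j (hσ i) (hσ j), ← Finset.sum_mul, hv i j]
  have hrow : ∀ i, ∑ b, ∑ a, ‖projectedBasis σ (v b) a i‖ ^ 2 = (r : ℝ) - 1 := by
    intro i
    simp only [← real_inner_self_eq_norm_sq, hgram, hd]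
    rw [real_inner_self_eq_norm_sq, hσ i]
    ring
  have hL : ∑ b, ∑ a, lam * ‖projectedBasis σ (v b) a‖ ^ 2 = lam * (n * ((r : ℝ) - 1)) := by
    simp only [← Finset.mul_sum,
      PiLp.norm_sq_eq_of_L2 (β := fun _ : Fin n => EuclideanSpace ℝ (Fin r))]
    congr 1
    calc _ = ∑ b, ∑ i, ∑ a, ‖projectedBasis σ (v b) a i‖ ^ 2 :=
          Finset.sum_congr rfl fun b _ => Finset.sum_comm
      _ = ∑ i, ∑ b, ∑ a, ‖projectedBasis σ (v b) a i‖ ^ 2 := Finset.sum_comm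
      _ = _ := by
        simp only [hrow, Finset.sum_const, Finset.card_univ, Fintype.card_fin, nsmul_eq_mul]
  have hR : ∑ b, ∑ a, hessForm (objective C) σ (projectedBasis σ (v b) a)
      = 2 * ((∑ i, ∑ j, C i j * (X i j * ((r : ℝ) - 2 + inner ℝ (σ i) (σ j) ^ 2)))
        - ((r : ℝ) - 1) * objective C σ) := by
    simp only [hessForm_objective hC hσ (projectedBasis_mem hσ _ _), ← Finset.mul_sum,
      Finset.sum_sub_distrib]
    have swap := fun g : Fin m → Fin r → Fin n → Fin n → ℝ => sum_comm_pairs g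
    rw [swap, swap]
    simp only [← Finset.mul_sum, hgram, hrow]
    rw [objective, Finset.mul_sum]
    congr 2
    refine Finset.sum_congr rfl fun i _ => ?_
    rw [Finset.mul_sum]
    refine Finset.sum_congr rfl fun j _ => ?_
    ring
  -- By the Schur product theorem `X i j * ⟨σ_i, σ_j⟩²` is again feasible; testing it with `-C`
  -- bounds the quadratic part of `hgram` by `-SDP(-C)`.
  have hS : (Matrix.gram ℝ fun i => σ i).PosSemidef := Matrix.posSemidef_gram ℝ _
  have hY := sdpValue_le (-C) ((hX.hadamard hS).hadamard hS) fun i => by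
    simp [Matrix.hadamard_apply, Matrix.gram_apply, hd, hσ i]
  have hsplit : (∑ i, ∑ j, C i j * (X i j * ((r : ℝ) - 2 + inner ℝ (σ i) (σ j) ^ 2)))
      = ((r : ℝ) - 2) * (∑ i, ∑ j, C i j * X i j)
        - ∑ i, ∑ j, (-C) i j *
          ((X ⊙ Matrix.gram ℝ fun i => σ i) ⊙ Matrix.gram ℝ fun i => σ i) i j := by
    rw [Finset.mul_sum, ← Finset.sum_sub_distrib]
    refine Finset.sum_congr rfl fun i _ => ?_
    rw [Finset.mul_sum, ← Finset.sum_sub_distrib]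
    refine Finset.sum_congr rfl fun j _ => ?_
    simp only [Matrix.hadamard_apply, Matrix.gram_apply, Matrix.neg_apply]
    ring
  rw [hL, hR, hsplit] at hsum
  linarith

/-- The Burer–Monteiro bound: a point whose Riemannian Hessian has no very negative eigenvalue
is almost as good as the target value. -/
theorem objective_sub_targetValue_le {n r : ℕ} (hn : 1 ≤ n) (hr : 2 ≤ r)
    {C : Matrix (Fin n) (Fin n) ℝ} (hC : C.IsSymm) {σ : Mat n r} (hσ : σ ∈ sphereProduct n r) :
    objective C σ - targetValue C r ≤ n / 2 * -hessMinEigenvalue (objective C) σ := by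
  have hr' : (2 : ℝ) ≤ r := by exact_mod_cast hr
  have key : hessMinEigenvalue (objective C) σ * (n * ((r : ℝ) - 1)) ≤
      2 * ((((r : ℝ) - 2) * sdpValue C) - sdpValue (-C) - ((r : ℝ) - 1) * objective C σ) := by
    refine le_of_forall_pos_lt_add fun η hη => ?_
    -- The error is multiplied by `2(r - 2)`, so `η / (2r)` keeps it below `η`.
    obtain ⟨X, hX, hd, hlt⟩ := exists_feasible_lt C (η := η / (2 * r)) (by positivity)
    have h1 := objective_le_of_feasible hn hr hC hσ hX hd
    have h2 : ((r : ℝ) - 2) * ∑ i, ∑ j, C i j * X i j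
        ≤ (r - 2) * (sdpValue C + η / (2 * r)) :=
      mul_le_mul_of_nonneg_left hlt.le (by linarith)
    have h3 : ((r : ℝ) - 2) * (η / (2 * r)) < η / 2 := by
      rw [show η / 2 = r * (η / (2 * r)) by field_simp]
      exact mul_lt_mul_of_pos_right (by linarith) (by positivity)
    linarith
  rw [targetValue]
  have h1 : 0 < (r : ℝ) - 1 := by linarith
  refine le_of_mul_le_mul_left ?_ h1
  have h2 : ((r : ℝ) - 1) * (1 / ((r : ℝ) - 1) * (sdpValue C + sdpValue (-C)))
      = sdpValue C + sdpValue (-C) := by field_simp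
  linarith

/-! ### Third-order expansion along geodesics -/

theorem le_of_hasDerivAt_le {f g f' g' : ℝ → ℝ} (hf : ∀ t, HasDerivAt f (f' t) t)
    (hg : ∀ t, HasDerivAt g (g' t) t) (h0 : f 0 ≤ g 0) (h : ∀ t, 0 ≤ t → f' t ≤ g' t)
    {t : ℝ} (ht : 0 ≤ t) : f t ≤ g t :=
  image_le_of_deriv_right_le_deriv_boundary (a := 0) (b := t)
    (fun s _ => (hf s).continuousAt.continuousWithinAt)
    (fun s _ => (hf s).hasDerivWithinAt) h0
    (fun s _ => (hg s).continuousAt.continuousWithinAt)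
    (fun s _ => (hg s).hasDerivWithinAt) (fun s hs => h s hs.1) ⟨ht, le_rfl⟩

/-- Integrate the one-sided bound on the third derivative three times. -/
theorem taylor_upper_bound_cubic {f f₁ f₂ f₃ : ℝ → ℝ} {M : ℝ} (h1 : ∀ t, HasDerivAt f (f₁ t) t)
    (h2 : ∀ t, HasDerivAt f₁ (f₂ t) t) (h3 : ∀ t, HasDerivAt f₂ (f₃ t) t)
    (hM : ∀ t, f₃ t ≤ M) {t : ℝ} (ht : 0 ≤ t) :
    f t ≤ f 0 + f₁ 0 * t + f₂ 0 / 2 * t ^ 2 + M / 6 * t ^ 3 := by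
  have e2 : ∀ t, 0 ≤ t → f₂ t ≤ f₂ 0 + M * t := fun t ht =>
    le_of_hasDerivAt_le (g := fun t => f₂ 0 + M * t) (g' := fun _ => M) h3
      (fun s => by simpa using ((hasDerivAt_id s).const_mul M).const_add (f₂ 0))
      (by simp) (fun s _ => hM s) ht
  have e1 : ∀ t, 0 ≤ t → f₁ t ≤ f₁ 0 + f₂ 0 * t + M / 2 * t ^ 2 := fun t ht =>
    le_of_hasDerivAt_le (g := fun t => f₁ 0 + f₂ 0 * t + M / 2 * t ^ 2)
      (g' := fun t => f₂ 0 + M * t) h2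
      (fun s => by
        refine ((((hasDerivAt_id s).const_mul (f₂ 0)).const_add (f₁ 0)).add
          (((hasDerivAt_id s).pow 2).const_mul (M / 2))).congr_deriv ?_
        simp
        ring)
      (by simp) e2 ht
  exact le_of_hasDerivAt_le (g := fun t => f 0 + f₁ 0 * t + f₂ 0 / 2 * t ^ 2 + M / 6 * t ^ 3)
      (g' := fun t => f₁ 0 + f₂ 0 * t + M / 2 * t ^ 2) h1
      (fun s => by
        refine (((((hasDerivAt_id s).const_mul (f₁ 0)).const_add (f 0)).add
          (((hasDerivAt_id s).pow 2).const_mul (f₂ 0 / 2))).add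
          (((hasDerivAt_id s).pow 3).const_mul (M / 6))).congr_deriv ?_
        simp
        ring)
      (by simp) e1 ht

section Arc

variable {F : Type*} [NormedAddCommGroup F] [InnerProductSpace ℝ F]

/-- The curve `cos (a t) x + sin (a t) w`. -/
noncomputable def arc (a : ℝ) (x w : F) (t : ℝ) : F :=
  Real.cos (a * t) • x + Real.sin (a * t) • w

theorem arc_zero (a : ℝ) (x w : F) : arc a x w 0 = x := by simp [arc]

theorem arc_neg (a : ℝ) (x w : F) (t : ℝ) : arc a (-x) (-w) t = -arc a x w t := by
  simp only [arc]
  module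

/-- Differentiation stays within the family of arcs, replacing `(x, w)` by `(w, -x)`; all higher
derivatives follow from this. -/
theorem hasDerivAt_arc (a : ℝ) (x w : F) (t : ℝ) :
    HasDerivAt (arc a x w) (a • arc a w (-x) t) t := by
  have h := (hasDerivAt_id t).const_mul a
  refine ((h.cos.smul_const x).add (h.sin.smul_const w)).congr_deriv ?_
  simp [arc]
  module

theorem norm_sq_arc {x w : F} (h : inner ℝ x w = 0) (a t : ℝ) :
    ‖arc a x w t‖ ^ 2 = Real.cos (a * t) ^ 2 * ‖x‖ ^ 2 + Real.sin (a * t) ^ 2 * ‖w‖ ^ 2 := by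
  have h' : inner ℝ w x = 0 := by rwa [real_inner_comm]
  rw [← real_inner_self_eq_norm_sq, ← real_inner_self_eq_norm_sq, ← real_inner_self_eq_norm_sq, arc]
  simp only [inner_add_left, inner_add_right, real_inner_smul_left, real_inner_smul_right, h, h']
  ring

/-- Only an inequality, since the normalized direction `w` is `0` for a row that does not move. -/
theorem norm_arc_le_one {x w : F} (h : inner ℝ x w = 0) (hx : ‖x‖ ≤ 1) (hw : ‖w‖ ≤ 1) (a t : ℝ) :
    ‖arc a x w t‖ ≤ 1 := by
  refine (sq_le_one_iff₀ (norm_nonneg _)).1 ?_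
  rw [norm_sq_arc h]
  have hx2 : ‖x‖ ^ 2 ≤ 1 := (sq_le_one_iff₀ (norm_nonneg _)).2 hx
  have hw2 : ‖w‖ ^ 2 ≤ 1 := (sq_le_one_iff₀ (norm_nonneg _)).2 hw
  nlinarith [Real.cos_sq_add_sin_sq (a * t), sq_nonneg (Real.cos (a * t)),
    sq_nonneg (Real.sin (a * t))]

variable {x y v w : F} {a b : ℝ}

theorem hasDerivAt_inner_arc (a b : ℝ) (x v y w : F) (t : ℝ) :
    HasDerivAt (fun t => inner ℝ (arc a x v t) (arc b y w t))
      (a * inner ℝ (arc a v (-x) t) (arc b y w t) + b * inner ℝ (arc a x v t) (arc b w (-y) t))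
      t := by
  refine ((hasDerivAt_arc a x v t).inner ℝ (hasDerivAt_arc b y w t)).congr_deriv ?_
  rw [real_inner_smul_left, real_inner_smul_right]
  ring

theorem hasDerivAt_inner_arc_deriv (a b : ℝ) (x v y w : F) (t : ℝ) :
    HasDerivAt (fun t => a * inner ℝ (arc a v (-x) t) (arc b y w t)
        + b * inner ℝ (arc a x v t) (arc b w (-y) t))
      (2 * a * b * inner ℝ (arc a v (-x) t) (arc b w (-y) t)
        - (a ^ 2 + b ^ 2) * inner ℝ (arc a x v t) (arc b y w t)) t := by
  refine (((hasDerivAt_inner_arc a b v (-x) y w t).const_mul a).add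
    ((hasDerivAt_inner_arc a b x v w (-y) t).const_mul b)).congr_deriv ?_
  simp only [arc_neg, inner_neg_left, inner_neg_right]
  ring

theorem hasDerivAt_inner_arc_deriv_deriv (a b : ℝ) (x v y w : F) (t : ℝ) :
    HasDerivAt (fun t => 2 * a * b * inner ℝ (arc a v (-x) t) (arc b w (-y) t)
        - (a ^ 2 + b ^ 2) * inner ℝ (arc a x v t) (arc b y w t))
      (-((3 * b ^ 2 * a + a ^ 3) * inner ℝ (arc a v (-x) t) (arc b y w t)
        + (3 * a ^ 2 * b + b ^ 3) * inner ℝ (arc a x v t) (arc b w (-y) t))) t := by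
  refine (((hasDerivAt_inner_arc a b v (-x) w (-y) t).const_mul (2 * a * b)).sub
    ((hasDerivAt_inner_arc a b x v y w t).const_mul (a ^ 2 + b ^ 2))).congr_deriv ?_
  simp only [arc_neg, inner_neg_left, inner_neg_right]
  ring

/-- The inner products are at most `1` in absolute value and the coefficients add up to `(a + b)³ ≤
4(a³ + b³)`. -/
theorem abs_third_deriv_inner_arc_le (ha : 0 ≤ a) (hb : 0 ≤ b) (hxv : inner ℝ x v = 0)
    (hyw : inner ℝ y w = 0) (hx : ‖x‖ ≤ 1) (hv : ‖v‖ ≤ 1) (hy : ‖y‖ ≤ 1) (hw : ‖w‖ ≤ 1) (t : ℝ) :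
    |-((3 * b ^ 2 * a + a ^ 3) * inner ℝ (arc a v (-x) t) (arc b y w t)
        + (3 * a ^ 2 * b + b ^ 3) * inner ℝ (arc a x v t) (arc b w (-y) t))|
      ≤ 4 * (a ^ 3 + b ^ 3) := by
  have hle : ∀ p q : F, ‖p‖ ≤ 1 → ‖q‖ ≤ 1 → |inner ℝ p q| ≤ 1 := fun p q hp hq =>
    (abs_real_inner_le_norm p q).trans (mul_le_one₀ hp (norm_nonneg _) hq)
  have hvx : inner ℝ v (-x) = 0 := by rw [inner_neg_right, real_inner_comm, hxv, neg_zero]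
  have hwy : inner ℝ w (-y) = 0 := by rw [inner_neg_right, real_inner_comm, hyw, neg_zero]
  have h1 := hle _ _ (norm_arc_le_one hvx hv ((norm_neg x).trans_le hx) a t)
    (norm_arc_le_one hyw hy hw b t)
  have h2 := hle _ _ (norm_arc_le_one hxv hx hv a t)
    (norm_arc_le_one hwy hw ((norm_neg y).trans_le hy) b t)
  rw [abs_neg]
  refine (abs_add_le _ _).trans ?_
  rw [abs_mul, abs_mul, abs_of_nonneg (show 0 ≤ 3 * b ^ 2 * a + a ^ 3 by positivity),
    abs_of_nonneg (show 0 ≤ 3 * a ^ 2 * b + b ^ 3 by positivity)]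
  have h3 := mul_le_of_le_one_right (show 0 ≤ 3 * b ^ 2 * a + a ^ 3 by positivity) h1
  have h4 := mul_le_of_le_one_right (show 0 ≤ 3 * a ^ 2 * b + b ^ 3 by positivity) h2
  have h5 : 0 ≤ 3 * (a + b) * (a - b) ^ 2 := by positivity
  linarith [h3, h4, h5, show 4 * (a ^ 3 + b ^ 3) - (3 * b ^ 2 * a + a ^ 3)
    - (3 * a ^ 2 * b + b ^ 3) = 3 * (a + b) * (a - b) ^ 2 by ring]

end Arc

/-- Apply the operator to a standard basis vector. -/
theorem sum_abs_col_le_opNormOne {n : ℕ} (C : Matrix (Fin n) (Fin n) ℝ) (j : Fin n) :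
    ∑ i, |C i j| ≤ opNormOne C := by
  have h := (LinearMap.toContinuousLinearMap (Matrix.toLpLin 1 1 C)).le_opNorm
    (WithLp.toLp 1 (Pi.single j (1 : ℝ)))
  have e1 : ‖(WithLp.toLp 1 (Pi.single j (1 : ℝ)) : PiLp 1 fun _ : Fin n => ℝ)‖ = 1 := by
    simp [PiLp.norm_eq_of_nat 1 (by norm_num : (1 : ENNReal) = ((1 : ℕ) : ENNReal)),
      apply_ite]
  rw [e1, mul_one] at h
  refine le_trans (le_of_eq ?_) h
  simp [PiLp.norm_eq_of_nat 1 (by norm_num : (1 : ENNReal) = ((1 : ℕ) : ENNReal))]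

theorem sum_abs_row_le_opNormOne {n : ℕ} {C : Matrix (Fin n) (Fin n) ℝ} (hC : C.IsSymm)
    (i : Fin n) : ∑ j, |C i j| ≤ opNormOne C := by
  simpa only [hC.apply] using sum_abs_col_le_opNormOne C i

theorem opNormOne_nonneg {n : ℕ} (C : Matrix (Fin n) (Fin n) ℝ) : 0 ≤ opNormOne C := norm_nonneg _

theorem geodesicStep_row {n r : ℕ} (σ u : Mat n r) (t : ℝ) (i : Fin n) :
    geodesicStep σ u t i = arc ‖u i‖ (σ i) (‖u i‖⁻¹ • u i) t := rfl

theorem norm_mul_inv_smul {F : Type*} [NormedAddCommGroup F] [NormedSpace ℝ F] (u : F) :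
    ‖u‖ • ‖u‖⁻¹ • u = u := by
  by_cases h : u = 0
  · simp [h]
  · rw [smul_inv_smul₀ (norm_ne_zero_iff.2 h)]

theorem norm_inv_smul_le_one {F : Type*} [NormedAddCommGroup F] [NormedSpace ℝ F] (u : F) :
    ‖‖u‖⁻¹ • u‖ ≤ 1 := by
  rw [norm_smul, norm_inv, norm_norm]
  exact inv_mul_le_one

theorem geodesicStep_mem {n r : ℕ} {σ u : Mat n r} (hσ : σ ∈ sphereProduct n r)
    (hu : u ∈ tangentSpace σ) (t : ℝ) : geodesicStep σ u t ∈ sphereProduct n r := by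
  intro i
  have h0 : inner ℝ (σ i) (‖u i‖⁻¹ • u i) = 0 := by rw [real_inner_smul_right, hu i, mul_zero]
  refine (sq_eq_sq₀ (norm_nonneg _) zero_le_one).1 ?_
  rw [geodesicStep_row, norm_sq_arc h0, hσ i]
  by_cases h : ‖u i‖ = 0
  · simp [h]
  · rw [norm_smul, norm_inv, norm_norm, inv_mul_cancel₀ h]
    simp

/-- The third derivative is at most `∑ |C i j| · 4(‖u_i‖³ + ‖u_j‖³)`. Row and column sums of `|C|`
are at most `‖C‖₁`, and `∑ ‖u_i‖³ ≤ ∑ ‖u_i‖² = 1`, which gives `8‖C‖₁`. -/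
theorem objective_geodesicStep_le {n r : ℕ} {C : Matrix (Fin n) (Fin n) ℝ} (hC : C.IsSymm)
    {σ u : Mat n r} (hσ : σ ∈ sphereProduct n r) (hu : u ∈ tangentSpace σ) (hu1 : ‖u‖ = 1)
    {t : ℝ} (ht : 0 ≤ t) :
    objective C (geodesicStep σ u t) ≤ objective C σ + inner ℝ u (riemGrad (objective C) σ) * t
      + hessForm (objective C) σ u / 2 * t ^ 2 + 8 * opNormOne C / 6 * t ^ 3 := by
  set a : Fin n → ℝ := fun i => ‖u i‖ with ha
  set w : Fin n → EuclideanSpace ℝ (Fin r) := fun i => ‖u i‖⁻¹ • u i with hw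
  have h0 : ∀ i, inner ℝ (σ i) (w i) = 0 := fun i => by
    rw [hw, real_inner_smul_right, hu i, mul_zero]
  have haw : ∀ i, a i • w i = u i := fun i => norm_mul_inv_smul (u i)
  have hw1 : ∀ i, ‖w i‖ ≤ 1 := fun i => norm_inv_smul_le_one (u i)
  have ha0 : ∀ i, 0 ≤ a i := fun i => norm_nonneg _
  have hasq : ∑ i, a i ^ 2 = 1 := by
    rw [← one_pow 2, ← hu1,
      PiLp.norm_sq_eq_of_L2 (β := fun _ : Fin n => EuclideanSpace ℝ (Fin r))]
  have ha1 : ∀ i, a i ≤ 1 := fun i => by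
    refine (sq_le_one_iff₀ (ha0 i)).1 ?_
    rw [← hasq]
    exact Finset.single_le_sum (fun k _ => sq_nonneg (a k)) (Finset.mem_univ i)
  have hcube : ∑ i, a i ^ 3 ≤ 1 := by
    rw [← hasq]
    exact Finset.sum_le_sum fun i _ => pow_le_pow_of_le_one (ha0 i) (ha1 i) (by norm_num)
  have hthird : ∀ t, ∑ i, ∑ j, C i j *
      -((3 * a j ^ 2 * a i + a i ^ 3) * inner ℝ (arc (a i) (w i) (-σ i) t) (arc (a j) (σ j) (w j) t)
        + (3 * a i ^ 2 * a j + a j ^ 3) *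
          inner ℝ (arc (a i) (σ i) (w i) t) (arc (a j) (w j) (-σ j) t)) ≤ 8 * opNormOne C := by
    intro t
    calc _ ≤ ∑ i, ∑ j, |C i j| * (4 * (a i ^ 3 + a j ^ 3)) := by
          refine Finset.sum_le_sum fun i _ => Finset.sum_le_sum fun j _ => ?_
          refine (le_abs_self _).trans ?_
          rw [abs_mul]
          exact mul_le_mul_of_nonneg_left (abs_third_deriv_inner_arc_le (ha0 i) (ha0 j) (h0 i)
            (h0 j) (hσ i).le (hw1 i) (hσ j).le (hw1 j) t) (abs_nonneg _)
      _ = 4 * (∑ i, a i ^ 3 * ∑ j, |C i j| + ∑ j, a j ^ 3 * ∑ i, |C i j|) := by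
          simp only [Finset.mul_sum]
          rw [Finset.sum_comm (f := fun j i => a j ^ 3 * |C i j|), ← Finset.sum_add_distrib,
            Finset.mul_sum]
          refine Finset.sum_congr rfl fun i _ => ?_
          rw [← Finset.sum_add_distrib, Finset.mul_sum]
          refine Finset.sum_congr rfl fun j _ => ?_
          ring
      _ ≤ 4 * (∑ i, a i ^ 3 * opNormOne C + ∑ i, a i ^ 3 * opNormOne C) := by
          gcongr with i _ i _
          · exact sum_abs_row_le_opNormOne hC i
          · exact sum_abs_col_le_opNormOne C i
      _ = 8 * ((∑ i, a i ^ 3) * opNormOne C) := by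
          rw [Finset.sum_mul]
          ring
      _ ≤ 8 * opNormOne C := by
          have := mul_le_of_le_one_left (opNormOne_nonneg C) hcube
          linarith
  have key := taylor_upper_bound_cubic
    (f := fun t => ∑ i, ∑ j, C i j * inner ℝ (arc (a i) (σ i) (w i) t) (arc (a j) (σ j) (w j) t))
    (fun t => HasDerivAt.fun_sum fun i _ => HasDerivAt.fun_sum fun j _ =>
      (hasDerivAt_inner_arc (a i) (a j) (σ i) (w i) (σ j) (w j) t).const_mul (C i j))
    (fun t => HasDerivAt.fun_sum fun i _ => HasDerivAt.fun_sum fun j _ =>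
      (hasDerivAt_inner_arc_deriv (a i) (a j) (σ i) (w i) (σ j) (w j) t).const_mul (C i j))
    (fun t => HasDerivAt.fun_sum fun i _ => HasDerivAt.fun_sum fun j _ =>
      (hasDerivAt_inner_arc_deriv_deriv (a i) (a j) (σ i) (w i) (σ j) (w j) t).const_mul (C i j))
    hthird ht
  simp only [arc_zero] at key
  have hwin : ∀ i (x : EuclideanSpace ℝ (Fin r)), a i * inner ℝ (w i) x = inner ℝ (u i) x :=
    fun i x => by rw [← real_inner_smul_left, haw]
  have hwin' : ∀ i (x : EuclideanSpace ℝ (Fin r)), a i * inner ℝ x (w i) = inner ℝ x (u i) :=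
    fun i x => by rw [← real_inner_smul_right, haw]
  have hww : ∀ i j, 2 * a i * a j * inner ℝ (w i) (w j) = 2 * inner ℝ (u i) (u j) := fun i j => by
    rw [← hwin, ← hwin']
    ring
  have e1 : ∑ i, ∑ j, C i j * (a i * inner ℝ (w i) (σ j) + a j * inner ℝ (σ i) (w j))
      = inner ℝ u (riemGrad (objective C) σ) := by
    rw [inner_riemGrad_objective hC hu, two_mul]
    simp only [hwin, hwin', mul_add, Finset.sum_add_distrib]
    congr 1
    rw [Finset.sum_comm]
    refine Finset.sum_congr rfl fun i _ => Finset.sum_congr rfl fun j _ => ?_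
    rw [hC.apply, real_inner_comm]
  have e2 : ∑ i, ∑ j, C i j * (2 * a i * a j * inner ℝ (w i) (w j)
      - (a i ^ 2 + a j ^ 2) * inner ℝ (σ i) (σ j)) = hessForm (objective C) σ u := by
    have hs : ∑ i, ∑ j, C i j * (inner ℝ (σ i) (σ j) * ‖u j‖ ^ 2)
        = ∑ i, ∑ j, C i j * (inner ℝ (σ i) (σ j) * ‖u i‖ ^ 2) := by
      rw [Finset.sum_comm]
      refine Finset.sum_congr rfl fun i _ => Finset.sum_congr rfl fun j _ => ?_
      rw [hC.apply, real_inner_comm]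
    rw [hessForm_objective hC hσ hu]
    calc _ = 2 * ∑ i, ∑ j, C i j * inner ℝ (u i) (u j)
          - (∑ i, ∑ j, C i j * (inner ℝ (σ i) (σ j) * ‖u i‖ ^ 2)
            + ∑ i, ∑ j, C i j * (inner ℝ (σ i) (σ j) * ‖u j‖ ^ 2)) := by
          simp only [hww, Finset.mul_sum, ← Finset.sum_add_distrib, ← Finset.sum_sub_distrib]
          refine Finset.sum_congr rfl fun i _ => Finset.sum_congr rfl fun j _ => ?_
          simp only [ha]
          ring
      _ = _ := by
          rw [hs]
          ring
  rw [e1, e2] at key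
  exact key

/-! ### Runs of the algorithm and the iteration count -/

section Algorithm

variable {n r : ℕ} {C : Matrix (Fin n) (Fin n) ℝ} {ρ ε Δ : ℝ}

theorem exists_isNormalizeRow (hr : 1 ≤ r) (γ : Mat n r) : ∃ τ : Mat n r, IsNormalizeRow γ τ := by
  have h : ∀ i, ∃ x : EuclideanSpace ℝ (Fin r), ‖x‖ = 1 ∧ γ i = ‖γ i‖ • x := by
    intro i
    by_cases h0 : γ i = 0
    · exact ⟨EuclideanSpace.single ⟨0, hr⟩ 1, by simp, by simp [h0]⟩
    · exact ⟨‖γ i‖⁻¹ • γ i, norm_smul_inv_norm h0, (norm_mul_inv_smul (γ i)).symm⟩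
  choose x hx using h
  exact ⟨WithLp.toLp 2 x, hx⟩

theorem exists_admmStep (hr : 1 ≤ r) (s : State n r) : ∃ s', AdmmStep C ρ s s' := by
  obtain ⟨τ, hτ⟩ := exists_isNormalizeRow hr (s.sigma - (1 / ρ) • (s.dual + matMul C s.sigma))
  set τ' := τ + (1 / ρ) • (s.dual - matMul C τ)
  exact ⟨⟨τ, τ', s.dual + ρ • (τ - τ')⟩, hτ, rfl, rfl⟩

theorem AdmmStep.tilde_mem {s s' : State n r} (h : AdmmStep C ρ s s') :
    s'.tilde ∈ sphereProduct n r := fun i => (h.1 i).1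

theorem Continues.tilde_mem {s s' : State n r} (h : Continues C ρ ε Δ s s')
    (hs : s.tilde ∈ sphereProduct n r) : s'.tilde ∈ sphereProduct n r := by
  cases h with
  | admm _ h _ => exact h.tilde_mem
  | curvature _ u _ _ hu _ => exact geodesicStep_mem hs hu.1 _

theorem Outputs.mem {N : ℕ} {s : State n r} {σ : Mat n r} (h : Outputs C ρ ε Δ N s σ)
    (hs : s.tilde ∈ sphereProduct n r) : σ ∈ sphereProduct n r := by
  induction h with
  | budget s => exact hs
  | halt N s _ => exact hs
  | step N s s' σ hc _ ih => exact ih (hc.tilde_mem hs)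

theorem exists_outputs (hn : 1 ≤ n) (hr : 2 ≤ r) (hC : C.IsSymm) (N : ℕ) {s : State n r}
    (hs : s.tilde ∈ sphereProduct n r) : ∃ σ, Outputs C ρ ε Δ N s σ := by
  induction N generalizing s with
  | zero => exact ⟨_, .budget s⟩
  | succ N ih =>
    have go : ∀ s', Continues C ρ ε Δ s s' → ∃ σ, Outputs C ρ ε Δ (N + 1) s σ := fun s' hc =>
      (ih (hc.tilde_mem hs)).imp fun σ hσ => .step N s s' σ hc hσ
    obtain ⟨s', hs'⟩ := exists_admmStep (C := C) (ρ := ρ) (by omega : 1 ≤ r) s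
    rcases le_or_gt Δ (merit C ρ s - merit C ρ s') with hd | hd
    · exact go s' (.admm s s' hs' hd)
    obtain ⟨u, hu⟩ := exists_isCurvatureDirection hn hr hC hs
    rcases lt_or_ge (hessForm (objective C) s.tilde u) (-(ε / 2)) with hl | hl
    · exact go _ (.curvature s s' u hs' hd hu hl)
    · exact ⟨_, .halt N s ⟨s', u, hs', hd, hu, hl⟩⟩

theorem objective_le_merit (C : Matrix (Fin n) (Fin n) ℝ) (hρ : 0 < ρ) (s : State n r) :
    objective C s.tilde ≤ merit C ρ s := by
  rw [merit]
  have : 0 ≤ ρ / 2 * ‖s.tilde - s.sigma‖ ^ 2 := by positivity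
  linarith

theorem merit_restart (C : Matrix (Fin n) (Fin n) ℝ) (ρ : ℝ) (τ : Mat n r) :
    merit C ρ (restart C τ) = objective C τ := by
  simp [merit, restart]

/-- Decrease of the objective along a negative-curvature step. -/
theorem objective_curvature_step_le (hC : C.IsSymm) {σ u : Mat n r} (hσ : σ ∈ sphereProduct n r)
    (hu : IsCurvatureDirection C σ u) (hneg : hessForm (objective C) σ u < 0) :
    2 / 675 * (-hessForm (objective C) σ u) ^ 3 ≤ opNormOne C ^ 2 *
      (objective C σ - objective C (geodesicStep σ u (stepLength C σ u))) := by
  have hbound := fun t ht => objective_geodesicStep_le hC hσ hu.1 hu.2.1 (t := t) ht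
  have hgrad := hu.2.2.2
  rw [stepLength]
  set lam := hessForm (objective C) σ u with hlam
  set L := opNormOne C with hL
  -- If `‖C‖₁ = 0` then `C = 0` and the Hessian form vanishes, against `hneg`.
  have hL0 : 0 < L := by
    refine lt_of_le_of_ne (opNormOne_nonneg C) fun h => ?_
    have hz : ∀ i j, C i j = 0 := fun i j => by
      have h1 := Finset.single_le_sum (f := fun k => |C k j|) (fun k _ => abs_nonneg _)
        (Finset.mem_univ i)
      have h2 := h1.trans (sum_abs_col_le_opNormOne C j)
      rw [← hL, ← h] at h2
      exact abs_nonpos_iff.1 h2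
    rw [hessForm_objective hC hσ hu.1] at hlam
    simp only [hz, zero_mul, Finset.sum_const_zero, sub_zero, mul_zero] at hlam
    exact hneg.ne hlam
  set t := -(2 / (15 * L)) * lam with ht
  have ht0 : 0 < t := by
    rw [ht, neg_mul, neg_pos]
    exact mul_neg_of_pos_of_neg (by positivity) hneg
  have htL : 15 * L * t = -2 * lam := by
    rw [ht]
    field_simp
  have h1 := hbound t ht0.le
  have h2 : inner ℝ u (riemGrad (objective C) σ) * t ≤ 0 :=
    mul_nonpos_of_nonpos_of_nonneg hgrad ht0.le
  -- Relaxes the cubic coefficient `8L/6` to `15L/6`; the prescribed `t` is the minimizer of the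
  -- relaxed model, whose value there is `-2(-λ_H)³/(675L²)`.
  have h3 : 0 ≤ 7 * L / 6 * t ^ 3 := by positivity
  have h4 : -(lam / 2 * t ^ 2 + 15 * L / 6 * t ^ 3)
      ≤ objective C σ - objective C (geodesicStep σ u t) := by linarith
  have h5 : L ^ 2 * -(lam / 2 * t ^ 2 + 15 * L / 6 * t ^ 3) = 2 / 675 * (-lam) ^ 3 := by
    have e : lam = -(15 * L * t) / 2 := by linarith
    rw [e]
    ring
  rw [← h5]
  exact mul_le_mul_of_nonneg_left h4 (by positivity)

/-- Convexity of `s ↦ 1/s²`: the graph lies above its tangent at `x`. -/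
theorem sub_div_sq_le_inv_sq_sub_inv_sq {x y : ℝ} (hy : 0 < y) (hyx : y ≤ x) :
    2 * (x - y) / x ^ 3 ≤ 1 / y ^ 2 - 1 / x ^ 2 := by
  have hx : 0 < x := hy.trans_le hyx
  rw [div_sub_div _ _ (by positivity) (by positivity), div_le_div_iff₀ (by positivity)
    (by positivity)]
  have h1 : 0 ≤ x ^ 2 * (x - y) * (x * (x + y) - 2 * y ^ 2) := by
    have : 0 ≤ x - y := by linarith
    have h2 : 0 ≤ x * (x + y) - 2 * y ^ 2 := by nlinarith
    positivity
  linarith [h1, show (1 * x ^ 2 - y ^ 2 * 1) * x ^ 3 - 2 * (x - y) * (y ^ 2 * x ^ 2)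
    = x ^ 2 * (x - y) * (x * (x + y) - 2 * y ^ 2) by ring]

/-- A negative-curvature step that ends above the target value increases the inverse square of
the gap by a fixed amount. -/
theorem inv_sq_gap_curvature_step (hn : 1 ≤ n) (hr : 2 ≤ r) (hC : C.IsSymm) {σ u : Mat n r}
    (hσ : σ ∈ sphereProduct n r) (hu : IsCurvatureDirection C σ u)
    (hneg : hessForm (objective C) σ u < 0)
    (hpos : 0 < objective C (geodesicStep σ u (stepLength C σ u)) - targetValue C r) :
    objective C (geodesicStep σ u (stepLength C σ u)) ≤ objective C σ ∧
    4 / (675 * (n : ℝ) ^ 3) ≤ opNormOne C ^ 2 *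
      (1 / (objective C (geodesicStep σ u (stepLength C σ u)) - targetValue C r) ^ 2
        - 1 / (objective C σ - targetValue C r) ^ 2) := by
  have hdec := objective_curvature_step_le hC hσ hu hneg
  have hgap := objective_sub_targetValue_le hn hr hC hσ
  have hlam := hu.2.2.1
  set lam := hessForm (objective C) σ u
  set y := objective C (geodesicStep σ u (stepLength C σ u)) - targetValue C r with hy
  set x := objective C σ - targetValue C r with hx
  have hn' : (0 : ℝ) < n := by exact_mod_cast hn
  have hxy : objective C σ - objective C (geodesicStep σ u (stepLength C σ u)) = x - y := by
    rw [hx, hy]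
    ring
  rw [hxy] at hdec
  have hlam3 : 0 < (-lam) ^ 3 := pow_pos (neg_pos.2 hneg) 3
  have hyx : y ≤ x := by
    by_contra! h
    have := mul_nonpos_of_nonneg_of_nonpos (sq_nonneg (opNormOne C)) (by linarith : x - y ≤ 0)
    linarith
  refine ⟨by linarith, ?_⟩
  have hx0 : 0 < x := hpos.trans_le hyx
  -- The factor `1/2` of the Burer–Monteiro bound cancels the factor `2` lost in `λ_H ≤ λ_min/2`.
  have hxl : x ≤ n * -lam := by
    refine hgap.trans ?_
    rw [div_mul_eq_mul_div, mul_div_assoc]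
    exact mul_le_mul_of_nonneg_left (by linarith) hn'.le
  have hx3 : x ^ 3 ≤ n ^ 3 * (-lam) ^ 3 := by
    rw [← mul_pow]
    exact pow_le_pow_left₀ hx0.le hxl 3
  calc 4 / (675 * (n : ℝ) ^ 3) ≤ opNormOne C ^ 2 * (2 * (x - y) / x ^ 3) := by
        rw [← mul_div_assoc, div_le_div_iff₀ (by positivity) (by positivity)]
        calc 4 * x ^ 3 ≤ 4 * (n ^ 3 * (-lam) ^ 3) := by linarith
          _ = 2 * (675 * n ^ 3) * (2 / 675 * (-lam) ^ 3) := by ring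
          _ ≤ 2 * (675 * n ^ 3) * (opNormOne C ^ 2 * (x - y)) :=
            mul_le_mul_of_nonneg_left hdec (by positivity)
          _ = _ := by ring
    _ ≤ _ := mul_le_mul_of_nonneg_left (sub_div_sq_le_inv_sq_sub_inv_sq hpos hyx) (sq_nonneg _)

theorem objective_le_of_stops (hn : 1 ≤ n) (hr : 2 ≤ r) (hC : C.IsSymm) {s : State n r}
    (hs : s.tilde ∈ sphereProduct n r) (h : Stops C ρ ε Δ s) :
    objective C s.tilde - targetValue C r ≤ n / 2 * ε := by
  obtain ⟨s', u, -, -, hu, hl⟩ := h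
  have := hu.2.2.1
  exact (objective_sub_targetValue_le hn hr hC hs).trans
    (mul_le_mul_of_nonneg_left (by linarith) (by positivity))

/-- If the output is above the required value, then the numbers `a` of accepted updates and `b` of
negative-curvature steps are controlled by the gap of the merit function. -/
theorem Outputs.exists_counts (hn : 1 ≤ n) (hr : 2 ≤ r) (hC : C.IsSymm) (hρ : 0 < ρ) (hε : 0 < ε)
    (hΔ : 0 ≤ Δ) {N : ℕ} {s : State n r} {σ : Mat n r} (h : Outputs C ρ ε Δ N s σ)
    (hs : s.tilde ∈ sphereProduct n r)
    (hbad : n / 2 * ε < objective C σ - targetValue C r) :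
    ∃ a b : ℕ, a + b = N ∧ n / 2 * ε < merit C ρ s - targetValue C r ∧
      a * Δ < merit C ρ s - targetValue C r ∧
      b * (4 / (675 * (n : ℝ) ^ 3)) ≤ opNormOne C ^ 2 *
        (1 / (n / 2 * ε) ^ 2 - 1 / (merit C ρ s - targetValue C r) ^ 2) := by
  have hη : 0 < n / 2 * ε := by
    have : (0 : ℝ) < n := by exact_mod_cast hn
    positivity
  -- The run is unwound from its end: all bounds refer to the merit of the current first state, and
  -- each earlier iteration adds one to `a` or `b`.
  induction h with
  | budget s =>
    have h1 : n / 2 * ε < merit C ρ s - targetValue C r := by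
      linarith [objective_le_merit C hρ s]
    refine ⟨0, 0, rfl, h1, by simpa using hη.trans h1, ?_⟩
    rw [Nat.cast_zero, zero_mul]
    refine mul_nonneg (sq_nonneg _) (sub_nonneg.2 ?_)
    gcongr
  | halt N s hhalt => exact absurd (objective_le_of_stops hn hr hC hs hhalt) (not_le.2 hbad)
  | step N s s' σ hc _ ih =>
    obtain ⟨a, b, hab, h1, h2, h3⟩ := ih (hc.tilde_mem hs) hbad
    cases hc with
    | admm _ _ hd =>
      have hle : merit C ρ s' - targetValue C r ≤ merit C ρ s - targetValue C r := by linarith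
      refine ⟨a + 1, b, by omega, h1.trans_le hle, ?_, h3.trans ?_⟩
      · push_cast
        linarith
      · have := hη.trans h1
        gcongr
    | curvature s'' u _ _ hu hl =>
      rw [merit_restart] at h1 h2 h3
      obtain ⟨h4, h5⟩ := inv_sq_gap_curvature_step hn hr hC hs hu (by linarith) (hη.trans h1)
      have hm := objective_le_merit C hρ s
      refine ⟨a, b + 1, by omega, by linarith, by linarith, ?_⟩
      have h6 : 0 < objective C s.tilde - targetValue C r := by linarith
      -- The step starts from the objective, which may lie below the merit; passing to the merit
      -- only lowers the inverse square.
      have h7 : opNormOne C ^ 2 * (1 / (merit C ρ s - targetValue C r) ^ 2)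
          ≤ opNormOne C ^ 2 * (1 / (objective C s.tilde - targetValue C r) ^ 2) := by
        gcongr
      push_cast
      linarith

theorem Outputs.objective_le (hn : 1 ≤ n) (hr : 2 ≤ r) (hC : C.IsSymm) (hρ : 0 < ρ) (hε : 0 < ε)
    (hΔ : 0 < Δ) {N : ℕ} {s : State n r} {σ : Mat n r} (h : Outputs C ρ ε Δ N s σ)
    (hs : s.tilde ∈ sphereProduct n r)
    (hN : ⌈(merit C ρ s - targetValue C r) / Δ⌉
      + ⌈675 * opNormOne C ^ 2 * (n : ℝ) / ε ^ 2⌉ ≤ (N : ℤ)) :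
    objective C σ ≤ targetValue C r + n / 2 * ε := by
  by_contra! hbad
  obtain ⟨a, b, rfl, -, h2, h3⟩ := h.exists_counts hn hr hC hρ hε hΔ.le hs (by linarith)
  have hn' : (0 : ℝ) < n := by exact_mod_cast hn
  -- Strictness here is what makes `N = T₁ + T₂` iterations enough, since `b` can equal `T₂`.
  have ha : (a : ℤ) < ⌈(merit C ρ s - targetValue C r) / Δ⌉ := by
    rw [Int.lt_ceil, lt_div_iff₀ hΔ]
    exact_mod_cast h2
  have hb : (b : ℤ) ≤ ⌈675 * opNormOne C ^ 2 * (n : ℝ) / ε ^ 2⌉ := by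
    have h4 : (b : ℝ) * (4 / (675 * (n : ℝ) ^ 3))
        ≤ opNormOne C ^ 2 * (1 / (n / 2 * ε) ^ 2) :=
      h3.trans (mul_le_mul_of_nonneg_left (sub_le_self _ (by positivity)) (sq_nonneg _))
    have h5 : (b : ℝ) ≤ 675 * opNormOne C ^ 2 * (n : ℝ) / ε ^ 2 := by
      have h6 := mul_le_mul_of_nonneg_right h4 (show 0 ≤ 675 * (n : ℝ) ^ 3 / 4 by positivity)
      calc (b : ℝ) = b * (4 / (675 * (n : ℝ) ^ 3)) * (675 * (n : ℝ) ^ 3 / 4) := by field_simp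
        _ ≤ _ := h6
        _ = _ := by
          field_simp
          norm_num
    have h7 := h5.trans (Int.le_ceil _)
    exact_mod_cast h7
  push_cast at hN
  linarith

end Algorithm

end ADMMBM2

theorem theorem3 (n r : ℕ) (hn : 1 ≤ n) (hr : 2 ≤ r)
    (C : Matrix (Fin n) (Fin n) ℝ) (hC : C.IsSymm)
    (ρ ε κ : ℝ) (hρ : 0 < ρ) (hε : 0 < ε) (hκ : 0 < κ)
    (σ₀ : ADMMBM2.Mat n r) (hσ₀ : σ₀ ∈ ADMMBM2.sphereProduct n r)
    (T₁ T₂ : ℤ)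
    (hT₁ : T₁ = ⌈(ADMMBM2.objective C σ₀ - ADMMBM2.targetValue C r) / (κ * ε ^ 2)⌉ ∨
      (0 ≤ ADMMBM2.targetValue C r ∧ T₁ = ⌈ADMMBM2.objective C σ₀ / (κ * ε ^ 2)⌉))
    (hT₂ : T₂ = ⌈675 * ADMMBM2.opNormOne C ^ 2 * (n : ℝ) / ε ^ 2⌉)
    (N : ℕ) (hN : T₁ + T₂ ≤ (N : ℤ)) :
    (∃ σ : ADMMBM2.Mat n r,
      ADMMBM2.Outputs C ρ ε (κ * ε ^ 2) N (ADMMBM2.restart C σ₀) σ) ∧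
    ∀ σ : ADMMBM2.Mat n r,
      ADMMBM2.Outputs C ρ ε (κ * ε ^ 2) N (ADMMBM2.restart C σ₀) σ →
        σ ∈ ADMMBM2.sphereProduct n r ∧
        ADMMBM2.objective C σ ≤
          ADMMBM2.sdpValue C
            - 1 / ((r : ℝ) - 1) * (ADMMBM2.sdpValue C + ADMMBM2.sdpValue (-C))
            + (n : ℝ) / 2 * ε := by
  refine ⟨ADMMBM2.exists_outputs hn hr hC N hσ₀, fun σ h => ⟨h.mem hσ₀, ?_⟩⟩
  have hΔ : 0 < κ * ε ^ 2 := by positivity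
  refine h.objective_le hn hr hC hρ hε hΔ hσ₀ ?_
  rw [ADMMBM2.merit_restart, ← hT₂]
  -- For `f* ≥ 0` the alternative `T₁` is at least the first one.
  have hle : ⌈(ADMMBM2.objective C σ₀ - ADMMBM2.targetValue C r) / (κ * ε ^ 2)⌉ ≤ T₁ := by
    rcases hT₁ with rfl | ⟨h0, rfl⟩
    · exact le_rfl
    · refine Int.ceil_mono ?_
      gcongr
      linarith
  linarith
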